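/- Let $M$ be a smooth Riemannian manifold of dimension $n\ge 1$ and let $\mathcal M=M\times\mathbb R^{+}$, with local coordinates $(x^1,\dots,x^n,v)$, $v=x^{n+1}>0$. For a nonzero velocity vector $\mathbf v\in T_pM$ put $N^i=v^i/|\mathbf v|$, $N_k=v_k/|\mathbf v|$. Let $\mathbf F$ be the force field of a Newtonian dynamical system on $M$ admitting the normal shift, i.e. a force field $\mathbf F=\mathbf F(p,\mathbf v)$ such that each point of $\mathcal M$ has an open neighbourhood $O$ with a smooth function $W$ on $O$ satisfying $W_v=\partial W/\partial v\ne 0$, and a smooth function $h$ of one variable on $W(O)$, for which $$F_k=\frac{h(W)\,N_k}{W_v}-v\sum_{i=1}^n\frac{\nabla_iW}{W_v}\bigl(2N^iN_k-\delta^i_k\bigr),\qquad \nabla_i W=\frac{\partial W}{\partial x^i},\quad v=|\mathbf v|, \tag{1.4}$$ whenever $(p,|\mathbf v|)\in O$. Let $U\subset T\mathcal M$ be the distribution attached to $\mathbf F$, given locally by $U=\operatorname{Ker}dW$, and let $s$ be the section of $T\mathcal M/U$ attached to $\mathbf F$, given locally by the class of $\frac{h(W)}{W_v}\frac{\partial}{\partial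 v}$ (neither depends on the choice of the pairs $(h,W)$). (a) If $s$ vanishes at no point of $\mathcal M$, then there is a global smooth closed 1-form $\omega$ on $\mathcal M$, with $\omega_{n+1}\neq 0$ everywhere, that determines $\mathbf F$ by $$F_k=\frac{N_k}{\omega_{n+1}}-v\sum_{i=1}^n\frac{\omega_i}{\omega_{n+1}}\bigl(2N^iN_k-\delta^i_k\bigr),\qquad v=|\mathbf v|. \tag{7.6}$$ (b) Such an $\omega$ exists if and only if the gauge normalization $h\equiv1$ holds globally: $\mathcal M$ is covered by open sets $O_\alpha$ carrying functions $W_\alpha$ such that the pair $(1,W_\alpha)$ gives $\mathbf F$ on $O_\alpha$ by (1.4), the differences $W_\alpha-W_\beta$ are locally constant on $O_\alpha\cap O_\beta$ (so the $W_\alpha$ are the branches of one multivalued function on $\mathcal M$), and every pair $(h,W)$ giving $\mathbf F$ on an open set $O$ is turned into $(1,W_\alpha)$ near each point of $O\cap O_\alpha$ by a gauge transformation $W\mapsto\rho\circ W$, $h\mapsto(h\circ\rho^{-1})\cdot(\rho'\circ\rho^{-1})$, with $\rho$ a diffeomorphism between open subsets of $\mathbb R$. -/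

import Mathlib

open Set Filter Topology Manifold Bundle
open scoped ContDiff

noncomputable section

namespace NormalShift

/-- The manifold `ℝ⁺` of positive real numbers, an open submanifold of `ℝ`. -/
abbrev PosReal : TopologicalSpace.Opens ℝ := ⟨Set.Ioi 0, isOpen_Ioi⟩

/-- The model with corners of `𝓜 = M × ℝ⁺`, for an `n`-dimensional manifold `M`. -/
abbrev cylModel (n : ℕ) :
    ModelWithCorners ℝ (EuclideanSpace ℝ (Fin n) × ℝ)
      (ModelProd (EuclideanSpace ℝ (Fin n)) ℝ) :=
  (𝓡 n).prod 𝓘(ℝ, ℝ)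

section Cylinder

variable {n : ℕ} {M : Type*} [TopologicalSpace M]
  [ChartedSpace (EuclideanSpace ℝ (Fin n)) M]

/-- The vector `∂/∂v` at a point `q` of `M × ℝ⁺`. -/
def vert (q : M × PosReal) : TangentSpace (cylModel n) q :=
  ((0, 1) : EuclideanSpace ℝ (Fin n) × ℝ)

/-- A vector `u` tangent to `M` at `p`, seen as the vector `(u, 0)` tangent to `M × ℝ⁺` at
`q = (p, v)`. -/
def horiz (q : M × PosReal) (u : TangentSpace (𝓡 n) q.1) : TangentSpace (cylModel n) q :=
  ((u, 0) : EuclideanSpace ℝ (Fin n) × ℝ)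

/-- `horiz` is the differential of the slice inclusion `p ↦ (p, v)`. -/
theorem mfderiv_slice (q : M × PosReal) (u : TangentSpace (𝓡 n) q.1) :
    mfderiv (𝓡 n) (cylModel n) (fun p : M => (p, q.2)) q.1 u = horiz q u := by
  rw [mfderiv_prod_left]; rfl

/-- The differential `dW` at `q` of a function `W` on `M × ℝ⁺`. -/
def differential (W : M × PosReal → ℝ) (q : M × PosReal) :
    TangentSpace (cylModel n) q →L[ℝ] ℝ :=
  mfderiv (cylModel n) 𝓘(ℝ, ℝ) W q

/-- A `1`-form (not necessarily continuous) on `M × ℝ⁺`. -/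
abbrev OneForm (n : ℕ) (M : Type*) [TopologicalSpace M]
    [ChartedSpace (EuclideanSpace ℝ (Fin n)) M] : Type _ :=
  (q : M × PosReal) → (TangentSpace (cylModel n) q →L[ℝ] ℝ)

/-- Smoothness of a `1`-form, as a section of the cotangent bundle. -/
def OneForm.IsSmooth [IsManifold (𝓡 n) ∞ M] (θ : OneForm n M) : Prop :=
  ContMDiff (cylModel n)
    ((cylModel n).prod 𝓘(ℝ, (EuclideanSpace ℝ (Fin n) × ℝ) →L[ℝ] ℝ)) ∞
    (fun q => TotalSpace.mk' ((EuclideanSpace ℝ (Fin n) × ℝ) →L[ℝ] ℝ)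
      (E := fun q : M × PosReal => (TangentSpace (cylModel n) q →L[ℝ] ℝ)) q (θ q))

/-- The coordinate expression of a `1`-form in the chart around `q₀`: the pull-back of the form
under the inverse of the chart. -/
def OneForm.inChart (θ : OneForm n M) (q₀ : M × PosReal)
    (y : EuclideanSpace ℝ (Fin n) × ℝ) :
    (EuclideanSpace ℝ (Fin n) × ℝ) →L[ℝ] ℝ :=
  (θ ((extChartAt (cylModel n) q₀).symm y)).comp
    (mfderiv 𝓘(ℝ, EuclideanSpace ℝ (Fin n) × ℝ) (cylModel n)
      (extChartAt (cylModel n) q₀).symm y)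

/-- Closedness of a `1`-form: `∂θᵢ/∂xʲ = ∂θⱼ/∂xⁱ` on the whole domain of the preferred chart
around each point.  (For smooth forms this is independent of the charts.) -/
def OneForm.IsClosed (θ : OneForm n M) : Prop :=
  ∀ q₀ : M × PosReal, ∀ y ∈ (extChartAt (cylModel n) q₀).target,
    ∀ ξ η : EuclideanSpace ℝ (Fin n) × ℝ,
      fderiv ℝ (θ.inChart q₀) y ξ η = fderiv ℝ (θ.inChart q₀) y η ξ

/-- The gauge transformation near a point `q`: near `q` the pair `(h', W')` is obtained from
`(h, W)` by `W' = ρ ∘ W`, `h' = (h ∘ ρ⁻¹) · (ρ' ∘ ρ⁻¹)`, for a diffeomorphism `ρ` between open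
subsets of the real line, the first of which contains `W q`. -/
def GaugeRelatedAt (q : M × PosReal) (h : ℝ → ℝ) (W : M × PosReal → ℝ)
    (h' : ℝ → ℝ) (W' : M × PosReal → ℝ) : Prop :=
  ∃ ρ : OpenPartialHomeomorph ℝ ℝ,
    ContDiffOn ℝ ∞ ρ ρ.source ∧ ContDiffOn ℝ ∞ ρ.symm ρ.target ∧ W q ∈ ρ.source ∧
    (∀ᶠ x in 𝓝 q, W' x = ρ (W x)) ∧
    ∀ w ∈ ρ.target, h' w = h (ρ.symm w) * deriv ρ (ρ.symm w)

end Cylinder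

section Riemannian

variable {n : ℕ} {M : Type*} [TopologicalSpace M]
  [ChartedSpace (EuclideanSpace ℝ (Fin n)) M]
  [RiemannianBundle (fun x : M => TangentSpace (𝓡 n) x)]

/-- A force field on `M`: a vector `F(p, v)` of `T_pM` for every `p` and every velocity `v` in
`T_pM`.  Only the values at `v ≠ 0` are ever used. -/
abbrev ForceField (n : ℕ) (M : Type*) [TopologicalSpace M]
    [ChartedSpace (EuclideanSpace ℝ (Fin n)) M] : Type _ :=
  (p : M) → TangentSpace (𝓡 n) p → TangentSpace (𝓡 n) p

/-- The point `(p, |v|)` of `M × ℝ⁺` given by a non-zero vector `v` at `p`. -/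
def speedPoint (p : M) (v : TangentSpace (𝓡 n) p) (hv : v ≠ 0) : M × PosReal :=
  (p, ⟨‖v‖, norm_pos_iff.mpr hv⟩)

/-- The unit vector `N = v / |v|`. -/
def unitVec (p : M) (v : TangentSpace (𝓡 n) p) : TangentSpace (𝓡 n) p := ‖v‖⁻¹ • v

/-- The contraction with `u` of the covector
`c Nₖ / α_{n+1} - |v| ∑ᵢ (αᵢ / α_{n+1}) (2 Nⁱ Nₖ - δⁱₖ)`,
where `α = (α₁, …, αₙ, α_{n+1})` is a covector at the point `(p, |v|)` of `M × ℝ⁺`. -/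
def forceExpr (c : ℝ) (p : M) (v : TangentSpace (𝓡 n) p) (hv : v ≠ 0)
    (α : TangentSpace (cylModel n) (speedPoint p v hv) →L[ℝ] ℝ)
    (u : TangentSpace (𝓡 n) p) : ℝ :=
  let q := speedPoint p v hv
  let N := unitVec p v
  c * inner ℝ N u / α (vert q)
    - ‖v‖ * ((2 * α (horiz q N) * inner ℝ N u - α (horiz q u)) / α (vert q))

/-- On the open set `O ⊆ M × ℝ⁺`, the force field `F` is given by the pair `(h, W)`: `W` is smooth
on `O` with `∂W/∂v ≠ 0`, `h` is smooth on the set of values of `W`, and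
`Fₖ = h(W) Nₖ / W_v - |v| ∑ᵢ (∇ᵢW / W_v) (2 Nⁱ Nₖ - δⁱₖ)`
for all non-zero velocities `v` at `p` with `(p, |v|) ∈ O`. -/
structure IsRepresentedOn (F : ForceField n M) (O : Set (M × PosReal))
    (h : ℝ → ℝ) (W : M × PosReal → ℝ) : Prop where
  isOpen : IsOpen O
  smooth_W : ContMDiffOn (cylModel n) 𝓘(ℝ, ℝ) ∞ W O
  smooth_h : ContDiffOn ℝ ∞ h (W '' O)
  deriv_ne : ∀ q ∈ O, differential (n := n) W q (vert q) ≠ 0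
  formula : ∀ (p : M) (v : TangentSpace (𝓡 n) p) (hv : v ≠ 0), speedPoint p v hv ∈ O →
    ∀ u : TangentSpace (𝓡 n) p,
      inner ℝ (F p v) u =
        forceExpr (h (W (speedPoint p v hv))) p v hv (differential W (speedPoint p v hv)) u

/-- The force fields of the Newtonian dynamical systems admitting the normal shift: near each point
of `M × ℝ⁺` they are given by a pair `(h, W)`, which may change from point to point. -/
def IsNormalShiftForce (F : ForceField n M) : Prop :=
  ∀ q : M × PosReal, ∃ (O : Set (M × PosReal)) (h : ℝ → ℝ) (W : M × PosReal → ℝ),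
    q ∈ O ∧ IsRepresentedOn F O h W

/-- The covector and the coefficient in `forceExpr` can be recovered, up to the obvious scaling. -/
theorem forceExpr_determines (hn : 1 ≤ n) (c c' : M × PosReal → ℝ) (α α' : OneForm n M)
    (q : M × PosReal)
    (h : ∀ (p : M) (v : TangentSpace (𝓡 n) p) (hv : v ≠ 0), speedPoint p v hv = q →
      ∀ u, forceExpr (c (speedPoint p v hv)) p v hv (α (speedPoint p v hv)) u =
        forceExpr (c' (speedPoint p v hv)) p v hv (α' (speedPoint p v hv)) u) :
    c q / α q (vert q) = c' q / α' q (vert q) ∧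
      ∀ u, α q (horiz q u) / α q (vert q) = α' q (horiz q u) / α' q (vert q) := by
  obtain ⟨p, r, hr⟩ := q
  have hr' : (0 : ℝ) < r := hr
  have key : ∀ N : TangentSpace (𝓡 n) p, ‖N‖ = 1 →
      c (p, ⟨r, hr⟩) / α (p, ⟨r, hr⟩) (vert _) = c' (p, ⟨r, hr⟩) / α' (p, ⟨r, hr⟩) (vert _) ∧
      α (p, ⟨r, hr⟩) (horiz _ N) / α (p, ⟨r, hr⟩) (vert _) =
        α' (p, ⟨r, hr⟩) (horiz _ N) / α' (p, ⟨r, hr⟩) (vert _) := by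
    intro N hN
    have aux : ∀ N : TangentSpace (𝓡 n) p, ‖N‖ = 1 →
        c (p, ⟨r, hr⟩) / α (p, ⟨r, hr⟩) (vert _) -
          r * (α (p, ⟨r, hr⟩) (horiz _ N) / α (p, ⟨r, hr⟩) (vert _)) =
        c' (p, ⟨r, hr⟩) / α' (p, ⟨r, hr⟩) (vert _) -
          r * (α' (p, ⟨r, hr⟩) (horiz _ N) / α' (p, ⟨r, hr⟩) (vert _)) := by
      intro N hN
      have hnorm : ‖r • N‖ = r := by rw [norm_smul, hN, Real.norm_of_nonneg hr'.le, mul_one]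
      have hv : r • N ≠ 0 := by
        rw [← norm_pos_iff, hnorm]; exact hr'
      have hq : speedPoint p (r • N) hv = (p, ⟨r, hr⟩) := by
        simp only [speedPoint, hnorm]
      have hu : unitVec p (r • N) = N := by
        rw [unitVec, hnorm, smul_smul, inv_mul_cancel₀ hr'.ne', one_smul]
      have hNN : inner ℝ N N = (1 : ℝ) := by
        rw [real_inner_self_eq_norm_sq, hN]; norm_num
      have e := h p (r • N) hv hq N
      have e1 : ∀ (c : M × PosReal → ℝ) (α : OneForm n M),
          forceExpr (c (speedPoint p (r • N) hv)) p (r • N) hv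
            (α (speedPoint p (r • N) hv)) N =
          c (p, ⟨r, hr⟩) / α (p, ⟨r, hr⟩) (vert _) -
          r * (α (p, ⟨r, hr⟩) (horiz _ N) / α (p, ⟨r, hr⟩) (vert _)) := by
        intro c α
        simp only [forceExpr, hu, hNN, hnorm]
        rw [hq]
        ring
      rw [e1, e1] at e
      exact e
    have a1 := aux N hN
    have a2 := aux (-N) (by rw [norm_neg, hN])
    have hneg : horiz (n := n) ((p, ⟨r, hr⟩) : M × PosReal) (-N) = -horiz (p, ⟨r, hr⟩) N := by
      have : ∀ x : EuclideanSpace ℝ (Fin n), ((-x, 0) : EuclideanSpace ℝ (Fin n) × ℝ) = -(x, 0) :=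
        fun x => by ext <;> simp
      exact this N
    rw [hneg, map_neg, map_neg, neg_div, neg_div] at a2
    refine ⟨by linarith, ?_⟩
    exact mul_left_cancel₀ hr'.ne' (by linarith)
  have hE : ∃ u : TangentSpace (𝓡 n) p, u ≠ 0 := by
    refine ⟨(EuclideanSpace.single ⟨0, hn⟩ (1 : ℝ) : EuclideanSpace ℝ (Fin n)), fun h0 => ?_⟩
    have : (EuclideanSpace.single ⟨0, hn⟩ (1 : ℝ) : EuclideanSpace ℝ (Fin n)) = 0 := h0
    simp at this
  have hunit : ∀ u : TangentSpace (𝓡 n) p, u ≠ 0 → ‖‖u‖⁻¹ • u‖ = 1 := by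
    intro u hu
    rw [norm_smul, norm_inv, norm_norm, inv_mul_cancel₀ (norm_ne_zero_iff.mpr hu)]
  refine ⟨?_, fun u => ?_⟩
  · obtain ⟨u, hu⟩ := hE
    exact (key _ (hunit u hu)).1
  · have hsmul : ∀ (a : ℝ) (w : TangentSpace (𝓡 n) p),
        horiz (n := n) ((p, ⟨r, hr⟩) : M × PosReal) (a • w) = a • horiz (p, ⟨r, hr⟩) w := by
      intro a w
      have : ∀ x : EuclideanSpace ℝ (Fin n),
          ((a • x, 0) : EuclideanSpace ℝ (Fin n) × ℝ) = a • (x, 0) := fun x => by ext <;> simp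
      exact this w
    by_cases hu : u = 0
    · subst hu
      have h0 := hsmul 0 0
      rw [zero_smul, zero_smul] at h0
      have h0' : horiz (n := n) ((p, ⟨r, hr⟩) : M × PosReal) 0 = 0 := h0
      simp only [h0', map_zero, zero_div]
    · have k := (key _ (hunit u hu)).2
      have hn0 : ‖u‖⁻¹ ≠ 0 := inv_ne_zero (norm_ne_zero_iff.mpr hu)
      rw [hsmul, map_smul, map_smul, smul_eq_mul, smul_eq_mul, mul_div_assoc, mul_div_assoc] at k
      exact mul_left_cancel₀ hn0 k

theorem IsRepresentedOn.agree (hn : 1 ≤ n) {F : ForceField n M} {O O' : Set (M × PosReal)}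
    {h h' : ℝ → ℝ} {W W' : M × PosReal → ℝ} (H : IsRepresentedOn F O h W)
    (H' : IsRepresentedOn F O' h' W') {q : M × PosReal} (hq : q ∈ O) (hq' : q ∈ O') :
    h (W q) / differential (n := n) W q (vert q) =
      h' (W' q) / differential (n := n) W' q (vert q) ∧
    ∀ u, differential (n := n) W q (horiz q u) / differential (n := n) W q (vert q) =
      differential (n := n) W' q (horiz q u) / differential (n := n) W' q (vert q) := by
  refine forceExpr_determines hn (fun q => h (W q)) (fun q => h' (W' q))
    (differential W) (differential W') q (fun p v hv e u => ?_)
  rw [← H.formula p v hv (by rw [e]; exact hq), ← H'.formula p v hv (by rw [e]; exact hq')]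

/-- The function `h` of a pair chosen near `q`. -/
def IsNormalShiftForce.h {F : ForceField n M} (hF : IsNormalShiftForce F) (q : M × PosReal) :
    ℝ → ℝ :=
  (hF q).choose_spec.choose

/-- The function `W` of a pair chosen near `q`. -/
def IsNormalShiftForce.W {F : ForceField n M} (hF : IsNormalShiftForce F) (q : M × PosReal) :
    M × PosReal → ℝ :=
  (hF q).choose_spec.choose_spec.choose

/-- The distribution `U = Ker σ` attached to `F`, where `σ` is the section of the projectivized
cotangent bundle of `M × ℝ⁺` represented locally by `dW`.  By `attachedDistribution_eq`
it does not depend on the choice of the pairs. -/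
def attachedDistribution {F : ForceField n M} (hF : IsNormalShiftForce F) (q : M × PosReal) :
    Submodule ℝ (TangentSpace (cylModel n) q) :=
  LinearMap.ker (differential (n := n) (hF.W q) q).toLinearMap

/-- The section `s` of the quotient bundle `T(M × ℝ⁺) / U` attached to `F`: the class of the
vector field `(h(W) / W_v) ∂/∂v`.  By `attachedSection_eq` it does not depend on the choice of
the pairs. -/
def attachedSection {F : ForceField n M} (hF : IsNormalShiftForce F) (q : M × PosReal) :
    TangentSpace (cylModel n) q ⧸ attachedDistribution hF q :=
  (attachedDistribution hF q).mkQ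
    ((hF.h q (hF.W q q) / differential (n := n) (hF.W q) q (vert q)) • vert q)

theorem IsNormalShiftForce.chosen {F : ForceField n M} (hF : IsNormalShiftForce F)
    (q : M × PosReal) : ∃ O, q ∈ O ∧ IsRepresentedOn F O (hF.h q) (hF.W q) :=
  ⟨(hF q).choose, (hF q).choose_spec.choose_spec.choose_spec⟩

/-- `U = Ker dW` for every pair `(h, W)` giving `F` near the point. -/
theorem attachedDistribution_eq (hn : 1 ≤ n) {F : ForceField n M} (hF : IsNormalShiftForce F)
    {O : Set (M × PosReal)} {h : ℝ → ℝ} {W : M × PosReal → ℝ} (H : IsRepresentedOn F O h W)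
    {q : M × PosReal} (hq : q ∈ O) :
    attachedDistribution hF q = LinearMap.ker (differential (n := n) W q).toLinearMap := by
  obtain ⟨O', hq', H'⟩ := hF.chosen q
  have e := (H'.agree hn H hq' hq).2
  have d := H.deriv_ne q hq
  have d' := H'.deriv_ne q hq'
  have dec : ∀ ξ : TangentSpace (cylModel n) q,
      ∃ (u : TangentSpace (𝓡 n) q.1) (t : ℝ), ξ = horiz q u + t • vert q := by
    intro ξ
    have : ∀ ξ : EuclideanSpace ℝ (Fin n) × ℝ, ξ = (ξ.1, 0) + ξ.2 • (0, 1) := by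
      intro ξ; ext <;> simp
    exact ⟨(show EuclideanSpace ℝ (Fin n) × ℝ from ξ).1,
      (show EuclideanSpace ℝ (Fin n) × ℝ from ξ).2, this ξ⟩
  ext ξ
  obtain ⟨u, t, rfl⟩ := dec ξ
  have eu := e u
  simp only [attachedDistribution, LinearMap.mem_ker, ContinuousLinearMap.coe_coe, map_add,
    map_smul, smul_eq_mul]
  rw [div_eq_div_iff d' d] at eu
  constructor
  · intro hz
    refine mul_right_cancel₀ d' ?_
    linear_combination -eu + differential (n := n) W q (vert q) * hz
  · intro hz
    refine mul_right_cancel₀ d ?_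
    linear_combination eu + differential (n := n) (hF.W q) q (vert q) * hz

/-- `s` is the class of `(h(W) / W_v) ∂/∂v` for every pair `(h, W)` giving `F` near the point. -/
theorem attachedSection_eq (hn : 1 ≤ n) {F : ForceField n M} (hF : IsNormalShiftForce F)
    {O : Set (M × PosReal)} {h : ℝ → ℝ} {W : M × PosReal → ℝ} (H : IsRepresentedOn F O h W)
    {q : M × PosReal} (hq : q ∈ O) :
    attachedSection hF q = (attachedDistribution hF q).mkQ
      ((h (W q) / differential (n := n) W q (vert q)) • vert q) := by
  obtain ⟨O', hq', H'⟩ := hF.chosen q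
  rw [attachedSection, (H'.agree hn H hq' hq).1]

/-- The `1`-form `θ` determines the force field `F`: its component `θ_{n+1}` does not vanish, and
`Fₖ = Nₖ / θ_{n+1} - |v| ∑ᵢ (θᵢ / θ_{n+1}) (2 Nⁱ Nₖ - δⁱₖ)` for all non-zero velocities. -/
structure OneForm.Determines (θ : OneForm n M) (F : ForceField n M) : Prop where
  vert_ne : ∀ q, θ q (vert q) ≠ 0
  formula : ∀ (p : M) (v : TangentSpace (𝓡 n) p) (hv : v ≠ 0) (u : TangentSpace (𝓡 n) p),
    inner ℝ (F p v) u = forceExpr 1 p v hv (θ (speedPoint p v hv)) u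

/-- The gauge normalization `h ≡ 1` holds globally: `M × ℝ⁺` is covered by open sets `O q` with
pairs `(1, W q)` giving `F` on `O q`; on overlaps the functions `W q` differ by locally constant
functions, so that they are the branches of one multivalued function on `M × ℝ⁺`; and any pair
giving `F` is turned into them by gauge transformations. -/
def IsGloballyNormalized (F : ForceField n M) : Prop :=
  ∃ (O : M × PosReal → Set (M × PosReal)) (W : M × PosReal → M × PosReal → ℝ),
    (∀ q, q ∈ O q ∧ IsRepresentedOn F (O q) (fun _ => 1) (W q)) ∧
    (∀ q q', ∀ x ∈ O q ∩ O q', ∃ c : ℝ, ∀ᶠ y in 𝓝 x, W q y = W q' y + c) ∧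
    (∀ (O' : Set (M × PosReal)) (h' : ℝ → ℝ) (W' : M × PosReal → ℝ),
      IsRepresentedOn F O' h' W' →
        ∀ q, ∀ x ∈ O q ∩ O', GaugeRelatedAt x h' W' (fun _ => 1) (W q))

end Riemannian

end NormalShift

end

/-!
Where `s ≠ 0` the coefficient `h(W)` of a pair `(h, W)` does not vanish. As `dW ≠ 0`, the function
`W` is open, so `h` is smooth and non-zero near the value of `W`; replacing `W` by `ρ ∘ W`, where
`ρ' = 1 / h`, gauges `h` to `1`. Two pairs `(1, W)`, `(1, W')` giving the same force have the same
differential, since their `v`-derivatives and the ratios of the other derivatives to them agree.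
Hence the `dW` glue to a form that is locally exact, that is, smooth and closed, and on overlaps the
functions `W` differ by locally constant ones. Conversely, by the Poincaré lemma a closed form `ω`
has local primitives `W`, and (7.6) for `ω` is (1.4) for the pair `(1, W)`.
-/

noncomputable section

namespace NormalShift

section ChartForm

variable {𝕜 : Type*} [NontriviallyNormedField 𝕜] {E : Type*} [NormedAddCommGroup E]
  [NormedSpace 𝕜 E] {H : Type*} [TopologicalSpace H] (I : ModelWithCorners 𝕜 E H) {X : Type*}
  [TopologicalSpace X] [ChartedSpace H X] {G : Type*} [NormedAddCommGroup G] [NormedSpace 𝕜 G]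

/-- The coordinate expression of a vector-valued `1`-form in the extended chart around `x₀`: its
pull-back under the inverse of the chart.  `OneForm.inChart` is the case of real forms on
`M × ℝ⁺`. -/
def chartForm (θ : (x : X) → TangentSpace I x →L[𝕜] G) (x₀ : X) (y : E) : E →L[𝕜] G :=
  (θ ((extChartAt I x₀).symm y)).comp (mfderiv 𝓘(𝕜, E) I (extChartAt I x₀).symm y)

variable {I} [I.Boundaryless]

theorem eventually_extChartAt_symm {x₀ : X} {y : E} (hy : y ∈ (extChartAt I x₀).target)
    {p : X → Prop} (hp : ∀ᶠ x in 𝓝 ((extChartAt I x₀).symm y), p x) :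
    ∀ᶠ z in 𝓝 y, z ∈ (extChartAt I x₀).target ∧ p ((extChartAt I x₀).symm z) :=
  have htarget := (isOpen_extChartAt_target x₀).mem_nhds hy
  (eventually_mem_set.2 htarget).and
    (((continuousOn_extChartAt_symm x₀).continuousAt htarget).eventually hp)

theorem contMDiffAt_extChartAt_symm {k : ℕ∞ω} [IsManifold I k X] {x₀ : X} {y : E}
    (hy : y ∈ (extChartAt I x₀).target) :
    ContMDiffAt 𝓘(𝕜, E) I k (extChartAt I x₀).symm y :=
  (contMDiffOn_extChartAt_symm x₀).contMDiffAt ((isOpen_extChartAt_target x₀).mem_nhds hy)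

section

variable [IsManifold I 1 X]

theorem mdifferentiableAt_extChartAt_symm {x₀ : X} {y : E}
    (hy : y ∈ (extChartAt I x₀).target) :
    MDifferentiableAt 𝓘(𝕜, E) I (extChartAt I x₀).symm y :=
  (contMDiffAt_extChartAt_symm (k := 1) hy).mdifferentiableAt one_ne_zero

theorem chartForm_mfderiv {f : X → G} {x₀ : X} {y : E} (hy : y ∈ (extChartAt I x₀).target)
    (hf : MDifferentiableAt I 𝓘(𝕜, G) f ((extChartAt I x₀).symm y)) :
    chartForm I (fun x => mfderiv I 𝓘(𝕜, G) f x) x₀ y =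
      fderiv 𝕜 (f ∘ (extChartAt I x₀).symm) y := by
  rw [← mfderiv_eq_fderiv, mfderiv_comp y hf (mdifferentiableAt_extChartAt_symm hy)]
  rfl

theorem chartForm_extChartAt (θ : (x : X) → TangentSpace I x →L[𝕜] G) {x₀ x : X}
    (hx : x ∈ (extChartAt I x₀).source) :
    chartForm I θ x₀ (extChartAt I x₀ x) =
      (θ x).comp ((trivializationAt E (TangentSpace I) x₀).symmL 𝕜 x) := by
  rw [TangentBundle.symmL_trivializationAt (by rwa [extChartAt_source] at hx), I.range_eq_univ,
    mfderivWithin_univ]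
  -- The point `x` occurs in the type of `θ x`, so the rewriting is done on the pair of the two.
  exact congrArg (fun x' => (show E →L[𝕜] G from θ x').comp _) ((extChartAt I x₀).left_inv hx)

theorem chartForm_comp_mfderiv_extChartAt (θ : (x : X) → TangentSpace I x →L[𝕜] G) {x₀ x : X}
    (hx : x ∈ (extChartAt I x₀).source) :
    (chartForm I θ x₀ (extChartAt I x₀ x)).comp (mfderiv I 𝓘(𝕜, E) (extChartAt I x₀) x) = θ x := by
  have hx' : x ∈ (chartAt H x₀).source := by rwa [extChartAt_source] at hx
  have hinv := mfderivWithin_extChartAt_symm_comp_mfderiv_extChartAt' (I := I) hx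
  rw [chartForm_extChartAt θ hx, TangentBundle.symmL_trivializationAt hx']
  exact (ContinuousLinearMap.comp_assoc ..).trans
    ((congrArg (θ x).comp hinv).trans (ContinuousLinearMap.comp_id _))

theorem mfderiv_comp_extChartAt {θ : (x : X) → TangentSpace I x →L[𝕜] G} {g : E → G} {x₀ x : X}
    (hx : x ∈ (extChartAt I x₀).source)
    (hg : HasFDerivAt g (chartForm I θ x₀ (extChartAt I x₀ x)) (extChartAt I x₀ x)) :
    mfderiv I 𝓘(𝕜, G) (g ∘ extChartAt I x₀) x = θ x := by
  have hx' : x ∈ (chartAt H x₀).source := by rwa [extChartAt_source] at hx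
  rw [mfderiv_comp x hg.differentiableAt.mdifferentiableAt (mdifferentiableAt_extChartAt hx'),
    mfderiv_eq_fderiv, hg.fderiv]
  exact chartForm_comp_mfderiv_extChartAt θ hx

theorem trivializationAt_form_apply (θ : (x : X) → TangentSpace I x →L[𝕜] G) {x₀ x : X}
    (hx : x ∈ (extChartAt I x₀).source) :
    (trivializationAt (E →L[𝕜] G) (fun x : X => TangentSpace I x →L[𝕜] G) x₀
      (TotalSpace.mk' (E →L[𝕜] G) (E := fun x : X => TangentSpace I x →L[𝕜] G) x (θ x))).2 =
      chartForm I θ x₀ (extChartAt I x₀ x) := by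
  rw [chartForm_extChartAt θ hx]
  have htrivial : (trivializationAt G (Bundle.Trivial X G) x₀).continuousLinearMapAt 𝕜 x =
    ContinuousLinearMap.id 𝕜 G := Bundle.Trivial.continuousLinearMapAt_trivialization 𝕜 X G x
  exact (congrArg (fun A : G →L[𝕜] G => A.comp ((show E →L[𝕜] G from θ x).comp _)) htrivial).trans
    (ContinuousLinearMap.id_comp _)

end

variable [IsManifold I ∞ X]

theorem contMDiffOn_form_iff (θ : (x : X) → TangentSpace I x →L[𝕜] G) (x₀ : X) :
    ContMDiffOn I (I.prod 𝓘(𝕜, E →L[𝕜] G)) ∞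
      (fun x => TotalSpace.mk' (E →L[𝕜] G) (E := fun x : X => TangentSpace I x →L[𝕜] G) x (θ x))
      (extChartAt I x₀).source ↔
    ContDiffOn 𝕜 ∞ (chartForm I θ x₀) (extChartAt I x₀).target := by
  have hbase : (trivializationAt (E →L[𝕜] G) (fun x : X => TangentSpace I x →L[𝕜] G) x₀).baseSet =
      (extChartAt I x₀).source := by
    rw [extChartAt_source]
    exact Set.inter_univ _
  rw [← hbase, Trivialization.contMDiffOn_section_baseSet_iff, hbase,
    contMDiffOn_congr fun x hx => trivializationAt_form_apply θ hx, ← contMDiffOn_iff_contDiffOn]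
  constructor
  · intro h
    refine (h.comp (contMDiffOn_extChartAt_symm x₀) fun y hy =>
      (extChartAt I x₀).map_target hy).congr fun y hy => ?_
    rw [Function.comp_apply, (extChartAt I x₀).right_inv hy]
  · intro h
    refine h.comp (t := (extChartAt I x₀).target) ?_ fun y hy => (extChartAt I x₀).map_source hy
    rw [extChartAt_source]
    exact contMDiffOn_extChartAt

theorem contMDiff_form_iff (θ : (x : X) → TangentSpace I x →L[𝕜] G) :
    ContMDiff I (I.prod 𝓘(𝕜, E →L[𝕜] G)) ∞
      (fun x => TotalSpace.mk' (E →L[𝕜] G) (E := fun x : X => TangentSpace I x →L[𝕜] G) x (θ x)) ↔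
    ∀ x₀, ContDiffOn 𝕜 ∞ (chartForm I θ x₀) (extChartAt I x₀).target := by
  simp_rw [← contMDiffOn_form_iff]
  exact ⟨fun h x₀ => h.contMDiffOn, fun h x =>
    (h x).contMDiffAt (extChartAt_source_mem_nhds x)⟩

end ChartForm

section LocallyExact

variable {E : Type*} [NormedAddCommGroup E] [NormedSpace ℝ E] {H : Type*} [TopologicalSpace H]
  {I : ModelWithCorners ℝ E H} {X : Type*} [TopologicalSpace X] [ChartedSpace H X]
  {G : Type*} [NormedAddCommGroup G] [NormedSpace ℝ G]

variable (I) in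
/-- Local exactness of a vector-valued `1`-form on a manifold: near each point it is the
differential of a smooth function. -/
def IsLocallyExact (θ : (x : X) → TangentSpace I x →L[ℝ] G) : Prop :=
  ∀ x, ∃ (O : Set X) (W : X → G), IsOpen O ∧ x ∈ O ∧ ContMDiffOn I 𝓘(ℝ, G) ∞ W O ∧
    ∀ z ∈ O, mfderiv I 𝓘(ℝ, G) W z = θ z

theorem exists_primitive_on_ball [CompleteSpace G] {θ : E → E →L[ℝ] G} {s : Set E} {y : E}
    (hs : s ∈ 𝓝 y) (hθ : ContDiffOn ℝ ∞ θ s)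
    (hclosed : ∀ z ∈ s, ∀ ξ η, fderiv ℝ θ z ξ η = fderiv ℝ θ z η ξ) :
    ∃ r > 0, ∃ w : E → G, ContDiffOn ℝ ∞ w (Metric.ball y r) ∧
      ∀ z ∈ Metric.ball y r, HasFDerivAt w (θ z) z := by
  obtain ⟨r, hr, hball⟩ := Metric.mem_nhds_iff.mp hs
  obtain ⟨w, hw⟩ := (convex_ball y r).exists_forall_hasFDerivAt_of_fderiv_symmetric
    Metric.isOpen_ball ((hθ.mono hball).differentiableOn (by simp)) fun z hz => hclosed z (hball hz)
  refine ⟨r, hr, w, ?_, hw⟩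
  rw [contDiffOn_infty_iff_fderiv_of_isOpen Metric.isOpen_ball]
  exact ⟨fun z hz => (hw z hz).differentiableAt.differentiableWithinAt,
    (hθ.mono hball).congr fun z hz => (hw z hz).fderiv⟩

variable [I.Boundaryless]

theorem map_nhds_eq_of_surjective_mfderiv [CompleteSpace E] [CompleteSpace G] [IsManifold I 1 X]
    {W : X → G} {x : X} (hW : ContMDiffAt I 𝓘(ℝ, G) 1 W x)
    (hsurj : Function.Surjective (mfderiv I 𝓘(ℝ, G) W x)) : map W (𝓝 x) = 𝓝 (W x) := by
  set w := W ∘ (extChartAt I x).symm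
  have hwx : w (extChartAt I x x) = W x := congrArg W (extChartAt_to_inv x)
  have hw : ContDiffAt ℝ 1 w (extChartAt I x x) := by
    refine (ContMDiffAt.comp _ ?_
      (contMDiffAt_extChartAt_symm (mem_extChartAt_target x))).contDiffAt
    rwa [extChartAt_to_inv]
  have hfderiv : mfderiv I 𝓘(ℝ, G) W x = fderiv ℝ w (extChartAt I x x) := by
    rw [(hW.mdifferentiableAt one_ne_zero).mfderiv, I.range_eq_univ, fderivWithin_univ]
    rfl
  have hmap : map w (𝓝 (extChartAt I x x)) = 𝓝 (w (extChartAt I x x)) :=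
    (hw.hasStrictFDerivAt one_ne_zero).map_nhds_eq_of_surj
      (LinearMap.range_eq_top.2 (by rwa [hfderiv] at hsurj))
  have hlocal : W =ᶠ[𝓝 x] w ∘ extChartAt I x := by
    filter_upwards [extChartAt_source_mem_nhds (I := I) x] with z hz
    exact congrArg W ((extChartAt I x).left_inv hz).symm
  rw [map_congr hlocal, ← map_map, map_extChartAt_nhds_of_boundaryless, hmap, hwx]

theorem eventually_eq_add_const_of_mfderiv_eq [IsManifold I 1 X] {W W' : X → G} {x : X}
    (hW : ∀ᶠ z in 𝓝 x, MDifferentiableAt I 𝓘(ℝ, G) W z)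
    (hW' : ∀ᶠ z in 𝓝 x, MDifferentiableAt I 𝓘(ℝ, G) W' z)
    (h : ∀ᶠ z in 𝓝 x, (mfderiv I 𝓘(ℝ, G) W z : E →L[ℝ] G) = mfderiv I 𝓘(ℝ, G) W' z) :
    ∃ c, ∀ᶠ z in 𝓝 x, W z = W' z + c := by
  have hchart := eventually_extChartAt_symm (mem_extChartAt_target (I := I) x)
    (p := fun z => (MDifferentiableAt I 𝓘(ℝ, G) W z ∧ MDifferentiableAt I 𝓘(ℝ, G) W' z) ∧
      (mfderiv I 𝓘(ℝ, G) W z : E →L[ℝ] G) = mfderiv I 𝓘(ℝ, G) W' z)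
    (by rw [extChartAt_to_inv]; exact (hW.and hW').and h)
  obtain ⟨r, hr, hball⟩ := Metric.mem_nhds_iff.mp hchart
  have hdiff {V : X → G} {y : E} (hy : y ∈ (extChartAt I x).target)
      (hV : MDifferentiableAt I 𝓘(ℝ, G) V ((extChartAt I x).symm y)) :
      DifferentiableAt ℝ (V ∘ (extChartAt I x).symm) y :=
    (hV.comp y (mdifferentiableAt_extChartAt_symm hy)).differentiableAt
  obtain ⟨c, hc⟩ := Metric.isOpen_ball.exists_eq_add_of_fderiv_eq
    (convex_ball (extChartAt I x x) r).isPreconnected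
    (f := W ∘ (extChartAt I x).symm) (g := W' ∘ (extChartAt I x).symm)
    (fun y hy => (hdiff (hball hy).1 (hball hy).2.1.1).differentiableWithinAt)
    (fun y hy => (hdiff (hball hy).1 (hball hy).2.1.2).differentiableWithinAt)
    fun y hy => by
      obtain ⟨htarget, ⟨hWy, hWy'⟩, heq⟩ := hball hy
      rw [← chartForm_mfderiv htarget hWy, ← chartForm_mfderiv htarget hWy']
      exact congrArg (fun A : E →L[ℝ] G => A.comp _) heq
  refine ⟨c, ?_⟩
  filter_upwards [extChartAt_source_mem_nhds (I := I) x,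
    (continuousAt_extChartAt (I := I) x).eventually (Metric.ball_mem_nhds _ hr)] with z hz hzball
  simpa only [Function.comp_apply, (extChartAt I x).left_inv hz] using hc hzball

variable [IsManifold I ∞ X] {θ : (x : X) → TangentSpace I x →L[ℝ] G}

theorem IsLocallyExact.exists_chartForm_eq_fderiv (hθ : IsLocallyExact I θ) {x₀ : X} {y : E}
    (hy : y ∈ (extChartAt I x₀).target) :
    ∃ w : E → G, ContDiffAt ℝ ∞ w y ∧ chartForm I θ x₀ =ᶠ[𝓝 y] fderiv ℝ w := by
  obtain ⟨O, W, hO, hyO, hW, hdW⟩ := hθ ((extChartAt I x₀).symm y)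
  have hWO {z : X} (hz : z ∈ O) : ContMDiffAt I 𝓘(ℝ, G) ∞ W z := hW.contMDiffAt (hO.mem_nhds hz)
  refine ⟨W ∘ (extChartAt I x₀).symm,
    ((hWO hyO).comp y (contMDiffAt_extChartAt_symm hy)).contDiffAt, ?_⟩
  filter_upwards [eventually_extChartAt_symm hy (hO.mem_nhds hyO)] with z ⟨hz, hzO⟩
  rw [← chartForm_mfderiv hz ((hWO hzO).mdifferentiableAt (by simp))]
  exact congrArg (fun A : E →L[ℝ] G => A.comp _) (hdW _ hzO).symm

theorem IsLocallyExact.contDiffOn_chartForm (hθ : IsLocallyExact I θ) (x₀ : X) :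
    ContDiffOn ℝ ∞ (chartForm I θ x₀) (extChartAt I x₀).target := fun _ hy =>
  have ⟨_, hw, heq⟩ := hθ.exists_chartForm_eq_fderiv hy
  ((hw.fderiv_right (m := ∞) le_rfl).congr_of_eventuallyEq heq).contDiffWithinAt

theorem IsLocallyExact.fderiv_chartForm_symm (hθ : IsLocallyExact I θ) {x₀ : X} {y : E}
    (hy : y ∈ (extChartAt I x₀).target) (ξ η : E) :
    fderiv ℝ (chartForm I θ x₀) y ξ η = fderiv ℝ (chartForm I θ x₀) y η ξ := by
  obtain ⟨w, hw, heq⟩ := hθ.exists_chartForm_eq_fderiv hy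
  have htwo : (2 : ℕ∞ω) ≤ ∞ := WithTop.coe_le_coe.2 le_top
  rw [heq.fderiv_eq]
  exact (hw.isSymmSndFDerivAt (by simpa using htwo)).eq ξ η

theorem isLocallyExact_of_fderiv_chartForm_symm [CompleteSpace G]
    (hsmooth : ∀ x₀, ContDiffOn ℝ ∞ (chartForm I θ x₀) (extChartAt I x₀).target)
    (hclosed : ∀ x₀, ∀ y ∈ (extChartAt I x₀).target, ∀ ξ η,
      fderiv ℝ (chartForm I θ x₀) y ξ η = fderiv ℝ (chartForm I θ x₀) y η ξ) :
    IsLocallyExact I θ := by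
  intro x
  obtain ⟨r, hr, w, hw, hdw⟩ :=
    exists_primitive_on_ball (extChartAt_target_mem_nhds x) (hsmooth x) (hclosed x)
  refine ⟨(extChartAt I x).source ∩ extChartAt I x ⁻¹' Metric.ball (extChartAt I x x) r,
    w ∘ extChartAt I x,
    (continuousOn_extChartAt x).isOpen_inter_preimage (isOpen_extChartAt_source x)
      Metric.isOpen_ball,
    ⟨mem_extChartAt_source x, Metric.mem_ball_self hr⟩, ?_,
    fun z hz => mfderiv_comp_extChartAt hz.1 (hdw _ hz.2)⟩
  refine hw.contMDiffOn.comp ?_ fun z hz => hz.2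
  exact contMDiffOn_extChartAt.mono fun z hz => by simpa only [extChartAt_source] using hz.1

theorem isLocallyExact_iff [CompleteSpace G] : IsLocallyExact I θ ↔
    (∀ x₀, ContDiffOn ℝ ∞ (chartForm I θ x₀) (extChartAt I x₀).target) ∧
    ∀ x₀, ∀ y ∈ (extChartAt I x₀).target, ∀ ξ η,
      fderiv ℝ (chartForm I θ x₀) y ξ η = fderiv ℝ (chartForm I θ x₀) y η ξ :=
  ⟨fun h => ⟨h.contDiffOn_chartForm, fun _ _ hy => h.fderiv_chartForm_symm hy⟩,
    fun h => isLocallyExact_of_fderiv_chartForm_symm h.1 h.2⟩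

end LocallyExact

section RealDiffeomorphism

variable {𝕜 : Type*} [RCLike 𝕜] {a : 𝕜}

theorem exists_openPartialHomeomorph_of_deriv_ne_zero {f : 𝕜 → 𝕜} {s : Set 𝕜} (hs : IsOpen s)
    (hf : ContDiffOn 𝕜 ∞ f s) (hf' : ∀ w ∈ s, deriv f w ≠ 0) (ha : a ∈ s) :
    ∃ ρ : OpenPartialHomeomorph 𝕜 𝕜, ⇑ρ = f ∧ a ∈ ρ.source ∧ ρ.source ⊆ s ∧
      ContDiffOn 𝕜 ∞ ρ.symm ρ.target := by
  have hfs {w : 𝕜} (hw : w ∈ s) : ContDiffAt 𝕜 ∞ f w := hf.contDiffAt (hs.mem_nhds hw)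
  have hderiv {w : 𝕜} (hw : w ∈ s) : HasDerivAt f (deriv f w) w :=
    ((hfs hw).differentiableAt (by simp)).hasDerivAt
  let ρ := ((hfs ha).toOpenPartialHomeomorph f
    ((hderiv ha).hasFDerivAt_equiv (hf' a ha)) (by simp)).restrOpen s hs
  refine ⟨ρ, rfl, ⟨(hfs ha).mem_toOpenPartialHomeomorph_source _ _, ha⟩, fun w hw => hw.2,
    fun w hw => ?_⟩
  have hws : ρ.symm w ∈ s := (ρ.map_target hw).2
  exact (ρ.contDiffAt_symm_deriv (hf' _ hws) hw (hderiv hws) (hfs hws)).contDiffWithinAt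

theorem exists_openPartialHomeomorph_deriv_eq {g : 𝕜 → 𝕜} {s : Set 𝕜} (hs : s ∈ 𝓝 a)
    (hg : ContDiffOn 𝕜 ∞ g s) (ha : g a ≠ 0) (b : 𝕜) :
    ∃ ρ : OpenPartialHomeomorph 𝕜 𝕜, a ∈ ρ.source ∧ ρ a = b ∧ ρ.source ⊆ s ∧
      ContDiffOn 𝕜 ∞ ρ ρ.source ∧ ContDiffOn 𝕜 ∞ ρ.symm ρ.target ∧
      ∀ w ∈ ρ.source, deriv ρ w = g w ∧ g w ≠ 0 := by
  have hne : ∀ᶠ w in 𝓝 a, g w ≠ 0 := (hg.contDiffAt hs).continuousAt.eventually_ne ha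
  obtain ⟨r, hr, hball⟩ := Metric.mem_nhds_iff.mp (inter_mem hs hne)
  have hgball : ContDiffOn 𝕜 ∞ g (Metric.ball a r) := hg.mono fun w hw => (hball hw).1
  obtain ⟨R, hR⟩ := (convex_ball a r).exists_forall_hasDerivWithinAt
    (hgball.differentiableOn (by simp))
  have hderiv (w) (hw : w ∈ Metric.ball a r) : HasDerivAt (fun w => R w + (b - R a)) (g w) w :=
    ((hR w hw).hasDerivAt (Metric.isOpen_ball.mem_nhds hw)).add_const _
  have hsmooth : ContDiffOn 𝕜 ∞ (fun w => R w + (b - R a)) (Metric.ball a r) := by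
    rw [contDiffOn_infty_iff_deriv_of_isOpen Metric.isOpen_ball]
    exact ⟨fun w hw => (hderiv w hw).differentiableAt.differentiableWithinAt,
      hgball.congr fun w hw => (hderiv w hw).deriv⟩
  obtain ⟨ρ, hρ, haρ, hsource, hsymm⟩ := exists_openPartialHomeomorph_of_deriv_ne_zero
    Metric.isOpen_ball hsmooth (fun w hw => (hderiv w hw).deriv ▸ (hball hw).2)
    (Metric.mem_ball_self hr)
  refine ⟨ρ, haρ, ?_, fun w hw => (hball (hsource hw)).1, hρ ▸ hsmooth.mono hsource, hsymm,
    fun w hw => ⟨hρ ▸ (hderiv w (hsource hw)).deriv, (hball (hsource hw)).2⟩⟩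
  rw [hρ]
  exact add_sub_cancel _ _

end RealDiffeomorphism

section Cylinder

variable {n : ℕ} {M : Type*} [TopologicalSpace M] [ChartedSpace (EuclideanSpace ℝ (Fin n)) M]

theorem covector_ext {q : M × PosReal} {α β : TangentSpace (cylModel n) q →L[ℝ] ℝ}
    (hhoriz : ∀ u, α (horiz q u) = β (horiz q u)) (hvert : α (vert q) = β (vert q)) : α = β :=
  ContinuousLinearMap.prod_ext (ContinuousLinearMap.ext hhoriz)
    (ContinuousLinearMap.ext_ring hvert)

theorem differential_comp {f : ℝ → ℝ} {W : M × PosReal → ℝ} {q : M × PosReal}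
    (hf : DifferentiableAt ℝ f (W q)) (hW : MDifferentiableAt (cylModel n) 𝓘(ℝ, ℝ) W q) :
    differential (n := n) (f ∘ W) q = deriv f (W q) • differential (n := n) W q := by
  rw [differential, mfderiv_comp q hf.mdifferentiableAt hW, mfderiv_eq_fderiv]
  exact ContinuousLinearMap.ext fun ξ => (fderiv_eq_deriv_mul (𝕜 := ℝ) :
    fderiv ℝ f (W q) (differential W q ξ) = deriv f (W q) * differential W q ξ)

theorem OneForm.isSmooth_and_isClosed_iff [IsManifold (𝓡 n) ∞ M] {θ : OneForm n M} :
    θ.IsSmooth ∧ θ.IsClosed ↔ IsLocallyExact (cylModel n) θ :=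
  ((contMDiff_form_iff θ).and Iff.rfl).trans isLocallyExact_iff.symm

end Cylinder

section Riemannian

variable {n : ℕ} {M : Type*} [TopologicalSpace M] [ChartedSpace (EuclideanSpace ℝ (Fin n)) M]
  [RiemannianBundle (fun x : M => TangentSpace (𝓡 n) x)] {F : ForceField n M}
  {O O' : Set (M × PosReal)} {h h' : ℝ → ℝ} {W W' : M × PosReal → ℝ} {q : M × PosReal}

theorem forceExpr_smul {a : ℝ} (ha : a ≠ 0) (c : ℝ) (p : M) (v : TangentSpace (𝓡 n) p)
    (hv : v ≠ 0) (α : TangentSpace (cylModel n) (speedPoint p v hv) →L[ℝ] ℝ)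
    (u : TangentSpace (𝓡 n) p) :
    forceExpr (a * c) p v hv (a • α) u = forceExpr c p v hv α u := by
  have hsmul (ξ) : (a • α) ξ = a * α ξ := rfl
  simp only [forceExpr, hsmul]
  congr 1
  · rw [mul_assoc, mul_div_mul_left _ _ ha]
  · rw [mul_left_comm 2 a, mul_assoc a, ← mul_sub, mul_div_mul_left _ _ ha]

namespace IsRepresentedOn

theorem contMDiffAt (H : IsRepresentedOn F O h W) (hq : q ∈ O) :
    ContMDiffAt (cylModel n) 𝓘(ℝ, ℝ) ∞ W q :=
  H.smooth_W.contMDiffAt (H.isOpen.mem_nhds hq)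

theorem mdifferentiableAt (H : IsRepresentedOn F O h W) (hq : q ∈ O) :
    MDifferentiableAt (cylModel n) 𝓘(ℝ, ℝ) W q :=
  (H.contMDiffAt hq).mdifferentiableAt (by simp)

theorem differential_surjective (H : IsRepresentedOn F O h W) (hq : q ∈ O) :
    Function.Surjective (differential (n := n) W q) :=
  LinearMap.surjective (f := (differential (n := n) W q).toLinearMap) fun h0 =>
    H.deriv_ne q hq (LinearMap.congr_fun h0 _)

theorem smul_differential_eq (hn : 1 ≤ n) (H : IsRepresentedOn F O h W)
    (H' : IsRepresentedOn F O' h' W') (hq : q ∈ O) (hq' : q ∈ O') :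
    h' (W' q) • differential (n := n) W q = h (W q) • differential (n := n) W' q := by
  obtain ⟨hcoeff, hratio⟩ := H.agree hn H' hq hq'
  have hv := H.deriv_ne q hq
  have hv' := H'.deriv_ne q hq'
  rw [div_eq_div_iff hv hv'] at hcoeff
  refine covector_ext (fun u => ?_) hcoeff.symm
  have hu := hratio u
  rw [div_eq_div_iff hv hv'] at hu
  change h' (W' q) * differential W q (horiz q u) = h (W q) * differential W' q (horiz q u)
  refine mul_right_cancel₀ hv' ?_
  linear_combination h' (W' q) * hu - differential (n := n) W' q (horiz q u) * hcoeff

theorem differential_eq (hn : 1 ≤ n) (H : IsRepresentedOn F O (fun _ => 1) W)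
    (H' : IsRepresentedOn F O' (fun _ => 1) W') (hq : q ∈ O) (hq' : q ∈ O') :
    differential (n := n) W q = differential (n := n) W' q := by
  simpa only [one_smul] using H.smul_differential_eq hn H' hq hq'

theorem ne_zero_of_normalized (hn : 1 ≤ n) (H : IsRepresentedOn F O (fun _ => 1) W)
    (H' : IsRepresentedOn F O' h' W') (hq : q ∈ O) (hq' : q ∈ O') : h' (W' q) ≠ 0 := by
  have hcoeff := (H.agree hn H' hq hq').1
  intro h0
  rw [h0, zero_div] at hcoeff
  exact one_div_ne_zero (H.deriv_ne q hq) hcoeff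

theorem comp_left (H : IsRepresentedOn F O h W) {f : ℝ → ℝ} {s : Set ℝ} (hs : IsOpen s)
    (hf : ContDiffOn ℝ ∞ f s) (hf' : ∀ w ∈ s, deriv f w ≠ 0) (hh' : ContDiffOn ℝ ∞ h' (f '' s))
    (heq : ∀ w ∈ s, h' (f w) = deriv f w * h w) :
    IsRepresentedOn F (O ∩ W ⁻¹' s) h' (f ∘ W) := by
  have hd {z} (hz : z ∈ O ∩ W ⁻¹' s) :
      differential (n := n) (f ∘ W) z = deriv f (W z) • differential (n := n) W z :=
    differential_comp ((hf.contDiffAt (hs.mem_nhds hz.2)).differentiableAt (by simp))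
      (H.mdifferentiableAt hz.1)
  refine ⟨H.smooth_W.continuousOn.isOpen_inter_preimage H.isOpen hs,
    hf.contMDiffOn.comp (H.smooth_W.mono inter_subset_left) fun z hz => hz.2, hh'.mono ?_,
    fun z hz => ?_, fun p v hv hz u => ?_⟩
  · rintro _ ⟨z, hz, rfl⟩
    exact mem_image_of_mem f hz.2
  · rw [hd hz]
    exact mul_ne_zero (hf' _ hz.2) (H.deriv_ne z hz.1)
  · rw [hd hz, Function.comp_apply, heq _ hz.2, forceExpr_smul (hf' _ hz.2)]
    exact H.formula p v hv hz.1 u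

variable [IsManifold (𝓡 n) ∞ M]

theorem exists_normalization (H : IsRepresentedOn F O h W) (hq : q ∈ O) (h0 : h (W q) ≠ 0)
    (b : ℝ) :
    ∃ ρ : OpenPartialHomeomorph ℝ ℝ, W q ∈ ρ.source ∧ ρ (W q) = b ∧
      ContDiffOn ℝ ∞ ρ ρ.source ∧ ContDiffOn ℝ ∞ ρ.symm ρ.target ∧
      (∀ w ∈ ρ.source, h w * deriv ρ w = 1) ∧
      IsRepresentedOn F (O ∩ W ⁻¹' ρ.source) (fun _ => 1) (ρ ∘ W) := by
  have himage : W '' O ∈ 𝓝 (W q) := by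
    rw [← map_nhds_eq_of_surjective_mfderiv ((H.contMDiffAt hq).of_le (by simp))
      (H.differential_surjective hq)]
    exact image_mem_map (H.isOpen.mem_nhds hq)
  have hne : ∀ᶠ w in 𝓝 (W q), h w ≠ 0 :=
    (H.smooth_h.contDiffAt himage).continuousAt.eventually_ne h0
  obtain ⟨ρ, hmem, hval, hsource, hρ, hsymm, hderiv⟩ :=
    exists_openPartialHomeomorph_deriv_eq (inter_mem himage hne)
      ((H.smooth_h.mono inter_subset_left).inv fun w hw => hw.2) (inv_ne_zero h0) b
  have hone (w) (hw : w ∈ ρ.source) : h w * deriv ρ w = 1 := by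
    rw [(hderiv w hw).1]
    exact mul_inv_cancel₀ (hsource hw).2
  exact ⟨ρ, hmem, hval, hρ, hsymm, hone, H.comp_left ρ.open_source hρ
    (fun w hw => right_ne_zero_of_mul_eq_one (hone w hw)) contDiffOn_const
    fun w hw => (mul_comm (h w) _ ▸ hone w hw).symm⟩

theorem eventually_eq_add_const (hn : 1 ≤ n) (H : IsRepresentedOn F O (fun _ => 1) W)
    (H' : IsRepresentedOn F O' (fun _ => 1) W') (hq : q ∈ O) (hq' : q ∈ O') :
    ∃ c, ∀ᶠ z in 𝓝 q, W z = W' z + c := by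
  have hO : ∀ᶠ z in 𝓝 q, z ∈ O := H.isOpen.mem_nhds hq
  have hO' : ∀ᶠ z in 𝓝 q, z ∈ O' := H'.isOpen.mem_nhds hq'
  exact eventually_eq_add_const_of_mfderiv_eq (hO.mono fun z => H.mdifferentiableAt)
    (hO'.mono fun z => H'.mdifferentiableAt)
    ((hO.and hO').mono fun z hz => H.differential_eq hn H' hz.1 hz.2)

theorem gaugeRelatedAt (hn : 1 ≤ n) (H : IsRepresentedOn F O (fun _ => 1) W)
    (H' : IsRepresentedOn F O' h' W') (hq : q ∈ O) (hq' : q ∈ O') :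
    GaugeRelatedAt q h' W' (fun _ => 1) W := by
  obtain ⟨ρ, hmem, hval, hρ, hsymm, hone, Hρ⟩ :=
    H'.exists_normalization hq' (H.ne_zero_of_normalized hn H' hq hq') (W q)
  obtain ⟨c, hc⟩ := H.eventually_eq_add_const hn Hρ hq ⟨hq', hmem⟩
  have hc0 : c = 0 := by simpa [hval] using hc.self_of_nhds
  refine ⟨ρ, hρ, hsymm, hmem, hc.mono fun z hz => ?_, fun w hw => (hone _ (ρ.map_target hw)).symm⟩
  rw [hz, hc0, add_zero, Function.comp_apply]

end IsRepresentedOn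

theorem attachedSection_eq_zero_iff (hn : 1 ≤ n) (hF : IsNormalShiftForce F)
    (H : IsRepresentedOn F O h W) (hq : q ∈ O) : attachedSection hF q = 0 ↔ h (W q) = 0 := by
  have hdW (c : ℝ) : differential (n := n) W q
      ((c / differential (n := n) W q (vert q)) • vert q) = c := by
    rw [map_smul, smul_eq_mul, div_mul_cancel₀ _ (H.deriv_ne q hq)]
  rw [attachedSection_eq hn hF H hq, Submodule.mkQ_apply, Submodule.Quotient.mk_eq_zero,
    attachedDistribution_eq hn hF H hq, LinearMap.mem_ker, ContinuousLinearMap.coe_coe, hdW]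

/-- The local form of the gauge normalization: near each point some pair `(1, W)` gives `F`. -/
def IsLocallyNormalizable (F : ForceField n M) : Prop :=
  ∀ q, ∃ (O : Set (M × PosReal)) (W : M × PosReal → ℝ),
    q ∈ O ∧ IsRepresentedOn F O (fun _ => 1) W

variable [IsManifold (𝓡 n) ∞ M]

theorem isLocallyNormalizable_iff_attachedSection_ne_zero (hn : 1 ≤ n) :
    IsLocallyNormalizable F ↔ ∃ hF : IsNormalShiftForce F, ∀ q, attachedSection hF q ≠ 0 := by
  constructor
  · intro hnorm
    have hF : IsNormalShiftForce F := fun q => by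
      obtain ⟨O, W, hq, H⟩ := hnorm q
      exact ⟨O, _, W, hq, H⟩
    refine ⟨hF, fun q => ?_⟩
    obtain ⟨O, W, hq, H⟩ := hnorm q
    exact (attachedSection_eq_zero_iff hn hF H hq).not.2 one_ne_zero
  · rintro ⟨hF, hs⟩ q
    obtain ⟨O, hq, H⟩ := hF.chosen q
    have h0 := (attachedSection_eq_zero_iff hn hF H hq).not.1 (hs q)
    obtain ⟨ρ, hmem, -, -, -, -, Hρ⟩ := H.exists_normalization hq h0 0
    exact ⟨_, _, mem_inter hq hmem, Hρ⟩

theorem isLocallyNormalizable_iff_exists_form (hn : 1 ≤ n) :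
    IsLocallyNormalizable F ↔ ∃ θ : OneForm n M, θ.IsSmooth ∧ θ.IsClosed ∧ θ.Determines F := by
  simp_rw [← and_assoc, OneForm.isSmooth_and_isClosed_iff]
  constructor
  · intro hnorm
    choose O W hqO H using hnorm
    exact ⟨fun q => differential (W q) q,
      fun q => ⟨O q, W q, (H q).isOpen, hqO q, (H q).smooth_W,
        fun z hz => (H q).differential_eq hn (H z) hz (hqO z)⟩,
      fun q => (H q).deriv_ne q (hqO q), fun p v hv => (H _).formula p v hv (hqO _)⟩
  · rintro ⟨θ, hexact, hdet⟩ q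
    obtain ⟨O, W, hO, hq, hW, hdW⟩ := hexact q
    refine ⟨O, W, hq, hO, hW, contDiffOn_const, fun z hz => ?_, fun p v hv hz u => ?_⟩
    · rw [differential, hdW z hz]
      exact hdet.vert_ne z
    · rw [differential, hdW _ hz]
      exact hdet.formula p v hv u

theorem isLocallyNormalizable_iff_isGloballyNormalized (hn : 1 ≤ n) :
    IsLocallyNormalizable F ↔ IsGloballyNormalized F := by
  constructor
  · intro hnorm
    choose O W hqO H using hnorm
    exact ⟨O, W, fun q => ⟨hqO q, H q⟩,
      fun q q' x hx => (H q).eventually_eq_add_const hn (H q') hx.1 hx.2,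
      fun _ _ _ H' q x hx => (H q).gaugeRelatedAt hn H' hx.1 hx.2⟩
  · rintro ⟨O, W, H, -⟩ q
    exact ⟨O q, W q, H q⟩

end Riemannian

end NormalShift

end

open NormalShift in
theorem theorem7p1_general {n : ℕ} (hn : 1 ≤ n) {M : Type*} [TopologicalSpace M]
    [ChartedSpace (EuclideanSpace ℝ (Fin n)) M] [IsManifold (𝓡 n) ∞ M]
    [RiemannianBundle (fun x : M => TangentSpace (𝓡 n) x)] (F : ForceField n M) :
    List.TFAE [∃ hF : IsNormalShiftForce F, ∀ q, attachedSection hF q ≠ 0,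
      ∃ θ : OneForm n M, θ.IsSmooth ∧ θ.IsClosed ∧ θ.Determines F,
      IsGloballyNormalized F] := by
  rw [← isLocallyNormalizable_iff_attachedSection_ne_zero hn,
    ← isLocallyNormalizable_iff_exists_form hn, ← isLocallyNormalizable_iff_isGloballyNormalized hn]
  simp

open NormalShift in
theorem theorem7p1 {n : ℕ} (hn : 1 ≤ n) {M : Type*} [TopologicalSpace M]
    [ChartedSpace (EuclideanSpace ℝ (Fin n)) M] [IsManifold (𝓡 n) ∞ M]
    [RiemannianBundle (fun x : M => TangentSpace (𝓡 n) x)]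
    [IsContMDiffRiemannianBundle (𝓡 n) ∞ (EuclideanSpace ℝ (Fin n))
      (fun x : M => TangentSpace (𝓡 n) x)]
    (F : ForceField n M) (hF : IsNormalShiftForce F) :
    ((∀ q, attachedSection hF q ≠ 0) →
      ∃ θ : OneForm n M, θ.IsSmooth ∧ θ.IsClosed ∧ θ.Determines F) ∧
    ((∃ θ : OneForm n M, θ.IsSmooth ∧ θ.IsClosed ∧ θ.Determines F) ↔
      IsGloballyNormalized F) :=
  have h := theorem7p1_general hn F
  ⟨fun hs => (h.out 0 1 rfl rfl).1 ⟨hF, hs⟩, h.out 1 2⟩
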